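/- Let $n$ be a non-negative integer, let $p \ge 2$ be real and let $q$ be defined by $1/p + 1/q = 1$. Let $\Phi(x) = |x|^p/p$ for $x \in \mathbb{R}^n$, where $|\cdot|$ is the Euclidean norm, and let $$d\mu_\Phi(x) = \frac{e^{-\Phi(x)}}{Z_\Phi}\,dx, \qquad Z_\Phi = \int_{\mathbb{R}^n} e^{-\Phi(x)}\,dx.$$ Then $\mu_\Phi$ is a probability measure on $\mathbb{R}^n$, and there is a constant $c > 0$ (depending only on $n$ and $p$) such that for every $C^1$ function $g : \mathbb{R}^n \to \mathbb{R}$ for which $e^g$ and $|\nabla g|^q e^g$ are $\mu_\Phi$-integrable, the function $e^g \log\bigl(e^g / \int e^g\,d\mu_\Phi\bigr)$ is $\mu_\Phi$-integrable and $$\mathrm{Ent}_{\mu_\Phi}(e^g) := \int e^g \log\frac{e^g}{\int e^g\,d\mu_\Phi}\,d\mu_\Phi \;\le\; c \int |\nabla g|^q\, e^g\,d\mu_\Phi .$$ -/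

import Mathlib

open MeasureTheory

noncomputable section

namespace ModifiedLogSobolev

/-- The probability measure `dμ_Φ(x) = e^{-Φ(x)} / Z_Φ dx`, `Z_Φ = ∫ e^{-Φ(x)} dx`, on `ℝⁿ` (meaningful
when `e^{-Φ}` is Lebesgue integrable). -/
def gibbs {n : ℕ} (Φ : EuclideanSpace ℝ (Fin n) → ℝ) : Measure (EuclideanSpace ℝ (Fin n)) :=
  volume.withDensity (fun x => ENNReal.ofReal (Real.exp (-Φ x) / ∫ y, Real.exp (-Φ y)))

/-- The integrand `f log (f / ∫ f dμ)` of the entropy of `f` with respect to `μ`. -/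
def entIntegrand {α : Type*} [MeasurableSpace α] (μ : Measure α) (f : α → ℝ) (x : α) : ℝ :=
  f x * Real.log (f x / ∫ y, f y ∂μ)

/-- The entropy `Ent_μ(f) = ∫ f log (f / ∫ f dμ) dμ`. -/
def ent {α : Type*} [MeasurableSpace α] (μ : Measure α) (f : α → ℝ) : ℝ :=
  ∫ x, entIntegrand μ f x ∂μ

/-- The potential `Φ(x) = |x|^p / p`, with the Euclidean norm on `ℝⁿ`. -/
def powerPotential (n : ℕ) (p : ℝ) (x : EuclideanSpace ℝ (Fin n)) : ℝ :=
  ‖x‖ ^ p / p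

end ModifiedLogSobolev

end

/-! The inequality is the infinitesimal form, as s → 0, of Prékopa–Leindler for a uniformly convex
potential. Write z = (1-s)x + sy and w = x - y, so that x = z + sw. For p ≥ 2 and 0 ≤ s ≤ 1/2, Φ(z)
lies below (1-s)Φ(x) + sΦ(y) by at least κs|w|^p (`norm_rpow_uniformly_convex`). For compactly
supported g, Young's inequality |∇g(z)||w| ≤ κ|w|^p + C|∇g(z)|^q yields g(x) ≤ g(z) + sH(z) +
κs|w|^p with H = C|∇g|^q + ε, for all small s, uniformly in z and w
(`HasCompactSupport.exists_forall_le_add_mul`).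

The two terms κs|w|^p cancel, so Prékopa–Leindler for e^{g/(1-s)}, 1 and e^{g+sH}, each weighted by
the density of μ, gives (∫ e^{g/(1-s)} dμ)^{1-s} ≤ ∫ e^{g+sH} dμ. Both sides agree at s = 0, where
their logarithms have derivatives Ent(e^g)/∫e^g and ∫He^g/∫e^g. Hence Ent(e^g) ≤ ∫ He^g
(`MeasureTheory.entropy_exp_le_of_rpow_integral_le`), and ε → 0.

General g is reached by spatial cutoff of bounded functions and by smooth truncation of e^g. Fatou's
lemma for the nonnegative function f log(f/m) - f + m, m = ∫f, carries both the bound and the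
integrability of the entropy integrand to the limit. -/

/-! ### The Prékopa–Leindler inequality. -/

/-- One-dimensional Brunn–Minkowski. For compact K and L, the translates K + min L and max K + L
both lie in C and meet at most in the point max K + min L. Inner regularity passes to measurable
sets. -/
theorem Real.volume_add_le_of_add_mem {A B C : Set ℝ} (hA : MeasurableSet A) (hB : MeasurableSet B)
    (hA0 : A.Nonempty) (hB0 : B.Nonempty) (hC : ∀ a ∈ A, ∀ b ∈ B, a + b ∈ C) :
    volume A + volume B ≤ volume C := by
  have key : ∀ K L : Set ℝ, IsCompact K → IsCompact L → K.Nonempty → L.Nonempty →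
      K ⊆ A → L ⊆ B → volume K + volume L ≤ volume C := by
    intro K L hK hL hK0 hL0 hKA hLB
    obtain ⟨M, hM, hMK⟩ := hK.exists_isGreatest hK0
    obtain ⟨m, hm, hmL⟩ := hL.exists_isLeast hL0
    have h1 : volume ((fun x => x + m) '' K) = volume K := by
      rw [Set.image_add_right, measure_preimage_add_right]
    have h2 : volume ((fun x => M + x) '' L) = volume L := by
      rw [Set.image_add_left, measure_preimage_add]
    have h3 : volume ((fun x => x + m) '' K ∩ (fun x => M + x) '' L) = 0 := by
      refine measure_mono_null (t := {M + m}) ?_ (by simp)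
      rintro _ ⟨⟨x, hx, rfl⟩, ⟨y, hy, hxy⟩⟩
      have := hMK hx
      have := hmL hy
      simp only [Set.mem_singleton_iff] at *
      linarith
    have h4 : MeasurableSet ((fun x => M + x) '' L) :=
      (hL.image (by fun_prop)).measurableSet
    rw [← h1, ← h2, ← measure_union_add_inter _ h4, h3, add_zero]
    refine measure_mono ?_
    rintro _ (⟨x, hx, rfl⟩ | ⟨x, hx, rfl⟩)
    · exact hC _ (hKA hx) _ (hLB hm)
    · exact hC _ (hKA hM) _ (hLB hx)
  obtain ⟨a, ha⟩ := hA0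
  obtain ⟨b, hb⟩ := hB0
  rw [hA.measure_eq_iSup_isCompact, hB.measure_eq_iSup_isCompact]
  simp only [iSup_and']
  refine ENNReal.biSup_add_biSup_le' (p := fun K : Set ℝ => K ⊆ A ∧ IsCompact K)
    (q := fun K : Set ℝ => K ⊆ B ∧ IsCompact K) ⟨∅, by simp⟩ ⟨∅, by simp⟩ ?_
  rintro K ⟨hKA, hK⟩ L ⟨hLB, hL⟩
  -- The suprema also run over empty compacts; adjoining a and b makes them nonempty.
  refine le_trans ?_ (key (insert a K) (insert b L) (hK.insert a) (hL.insert b) (by simp) (by simp)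
    (Set.insert_subset ha hKA) (Set.insert_subset hb hLB))
  gcongr <;> simp

theorem ENNReal.geom_mean_le_arith_mean2_weighted {t s : ℝ} (ht : 0 < t) (hs : 0 < s)
    (hts : t + s = 1) (a b : ENNReal) :
    a ^ t * b ^ s ≤ ENNReal.ofReal t * a + ENNReal.ofReal s * b := by
  by_cases ha : a = ⊤
  · simp [ha, ENNReal.mul_top, ht]
  by_cases hb : b = ⊤
  · simp [hb, ENNReal.mul_top, hs]
  lift a to NNReal using ha
  lift b to NNReal using hb
  have := NNReal.geom_mean_le_arith_mean2_weighted t.toNNReal s.toNNReal a b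
    (by rw [← Real.toNNReal_add ht.le hs.le, hts, Real.toNNReal_one])
  rw [Real.coe_toNNReal _ ht.le, Real.coe_toNNReal _ hs.le] at this
  rw [← ENNReal.coe_rpow_of_nonneg _ ht.le, ← ENNReal.coe_rpow_of_nonneg _ hs.le]
  unfold ENNReal.ofReal
  exact_mod_cast this

theorem lintegral_eq_lintegral_meas_ofReal_lt {α : Type*} [MeasurableSpace α] (μ : Measure α)
    {F : α → ENNReal} (hF : Measurable F) (hF1 : ∀ x, F x ≠ ⊤) :
    ∫⁻ x, F x ∂μ = ∫⁻ r in Set.Ioi (0 : ℝ), μ {x | ENNReal.ofReal r < F x} := by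
  have h := lintegral_eq_lintegral_meas_lt μ (f := fun x => (F x).toReal)
    (Filter.Eventually.of_forall fun x => ENNReal.toReal_nonneg)
    hF.ennreal_toReal.aemeasurable
  simp only [ENNReal.ofReal_toReal (hF1 _)] at h
  rw [h]
  refine setLIntegral_congr_fun measurableSet_Ioi fun r hr => ?_
  congr 1
  ext x
  exact (ENNReal.ofReal_lt_iff_lt_toReal (le_of_lt hr) (hF1 x)).symm

/-- Layer cake: t{f > r} + s{g > r} ⊆ {h > r}, and Brunn–Minkowski compares lengths level by level.
Equal suprema make both superlevel sets nonempty for exactly the same levels, r < 1. -/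
theorem Real.arith_lintegral_le_of_rpow_mul_rpow_le {t s : ℝ} (ht : 0 < t) (hs : 0 < s)
    (hts : t + s = 1)
    {f g h : ℝ → ENNReal} (hf : Measurable f) (hg : Measurable g) (hh : Measurable h)
    (hf1 : ⨆ x, f x = 1) (hg1 : ⨆ x, g x = 1)
    (H : ∀ x y, f x ^ t * g y ^ s ≤ h (t * x + s * y)) :
    ENNReal.ofReal t * (∫⁻ x, f x) + ENNReal.ofReal s * (∫⁻ x, g x) ≤ ∫⁻ x, h x := by
  have hf2 : ∀ x, f x ≤ 1 := fun x => hf1 ▸ le_iSup f x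
  have hg2 : ∀ x, g x ≤ 1 := fun x => hg1 ▸ le_iSup g x
  -- The layer-cake formula is stated for finite functions, and only levels below 1 matter, so h is
  -- capped at 1.
  have hmin : ∫⁻ x, min (h x) 1 ≤ ∫⁻ x, h x := lintegral_mono fun x => min_le_left _ _
  refine le_trans ?_ hmin
  rw [lintegral_eq_lintegral_meas_ofReal_lt _ hf fun x => ne_top_of_le_ne_top (by simp) (hf2 x),
    lintegral_eq_lintegral_meas_ofReal_lt _ hg fun x => ne_top_of_le_ne_top (by simp) (hg2 x),
    lintegral_eq_lintegral_meas_ofReal_lt _ (hh.min measurable_const)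
      fun x => ne_top_of_le_ne_top (by simp) (min_le_right _ _),
    ← lintegral_const_mul' _ _ (by simp), ← lintegral_const_mul' _ _ (by simp)]
  refine (le_lintegral_add _ _).trans (setLIntegral_mono' measurableSet_Ioi fun r hr => ?_)
  have hr0 : 0 < r := hr
  rcases le_or_gt 1 r with h1 | h1
  · have hle : (1 : ENNReal) ≤ ENNReal.ofReal r := by simpa using h1
    have e1 : {x | ENNReal.ofReal r < f x} = ∅ :=
      Set.eq_empty_of_forall_notMem fun x hx => absurd (hx.trans_le ((hf2 x).trans hle)) (lt_irrefl _)
    have e2 : {x | ENNReal.ofReal r < g x} = ∅ :=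
      Set.eq_empty_of_forall_notMem fun x hx => absurd (hx.trans_le ((hg2 x).trans hle)) (lt_irrefl _)
    simp [e1, e2]
  have hlt : ENNReal.ofReal r < 1 := by simpa using h1
  have hA0 : {x | ENNReal.ofReal r < f x}.Nonempty := by
    obtain ⟨x, hx⟩ := lt_iSup_iff.1 (hf1 ▸ hlt)
    exact ⟨x, hx⟩
  have hB0 : {x | ENNReal.ofReal r < g x}.Nonempty := by
    obtain ⟨x, hx⟩ := lt_iSup_iff.1 (hg1 ▸ hlt)
    exact ⟨x, hx⟩
  have hA : MeasurableSet {x | ENNReal.ofReal r < f x} := measurableSet_lt measurable_const hf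
  have hB : MeasurableSet {x | ENNReal.ofReal r < g x} := measurableSet_lt measurable_const hg
  have scale : ∀ (c : ℝ), 0 < c → ∀ S : Set ℝ,
      volume ((c⁻¹ * ·) ⁻¹' S) = ENNReal.ofReal c * volume S := by
    intro c hc S
    rw [Real.volume_preimage_mul_left (inv_ne_zero hc.ne'), inv_inv, abs_of_pos hc]
  rw [← scale t ht, ← scale s hs]
  refine Real.volume_add_le_of_add_mem (hA.preimage (by fun_prop)) (hB.preimage (by fun_prop))
    ?_ ?_ ?_
  · obtain ⟨x, hx⟩ := hA0
    exact ⟨t * x, by simpa [ht.ne'] using hx⟩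
  · obtain ⟨x, hx⟩ := hB0
    exact ⟨s * x, by simpa [hs.ne'] using hx⟩
  · intro a ha b hb
    simp only [Set.mem_preimage, Set.mem_ofPred_eq] at ha hb ⊢
    have h2 := H (t⁻¹ * a) (s⁻¹ * b)
    rw [mul_inv_cancel_left₀ ht.ne', mul_inv_cancel_left₀ hs.ne'] at h2
    refine lt_min (lt_of_lt_of_le ?_ h2) hlt
    calc ENNReal.ofReal r = ENNReal.ofReal r ^ t * ENNReal.ofReal r ^ s := by
          rw [← ENNReal.rpow_add _ _ (by simpa using hr0) (by simp), hts, ENNReal.rpow_one]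
      _ < f (t⁻¹ * a) ^ t * g (s⁻¹ * b) ^ s :=
          ENNReal.mul_lt_mul (ENNReal.rpow_lt_rpow ha ht) (ENNReal.rpow_lt_rpow hb hs)

/-- Both sides scale by the same factor when f and g are multiplied by constants. Normalising the
suprema to 1 allows the arithmetic form, which is stronger than the geometric one. -/
theorem Real.prekopa_leindler_of_bounded {t s : ℝ} (ht : 0 < t) (hs : 0 < s) (hts : t + s = 1)
    {f g h : ℝ → ENNReal} (hf : Measurable f) (hg : Measurable g) (hh : Measurable h)
    (hf1 : ⨆ x, f x ≠ ⊤) (hg1 : ⨆ x, g x ≠ ⊤)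
    (H : ∀ x y, f x ^ t * g y ^ s ≤ h (t * x + s * y)) :
    (∫⁻ x, f x) ^ t * (∫⁻ x, g x) ^ s ≤ ∫⁻ x, h x := by
  set A := ⨆ x, f x with hA
  set B := ⨆ x, g x with hB
  by_cases hA0 : A = 0
  · have : ∀ x, f x = 0 := by simpa [hA] using hA0
    simp [this, ht]
  by_cases hB0 : B = 0
  · have : ∀ x, g x = 0 := by simpa [hB] using hB0
    simp [this, hs]
  have key := Real.arith_lintegral_le_of_rpow_mul_rpow_le ht hs hts
    (f := fun x => A⁻¹ * f x) (g := fun x => B⁻¹ * g x) (h := fun x => (A⁻¹ ^ t * B⁻¹ ^ s) * h x)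
    (by fun_prop) (by fun_prop) (by fun_prop)
    (by rw [← ENNReal.mul_iSup, ENNReal.inv_mul_cancel hA0 hf1])
    (by rw [← ENNReal.mul_iSup, ENNReal.inv_mul_cancel hB0 hg1])
    (by
      intro x y
      rw [ENNReal.mul_rpow_of_nonneg _ _ ht.le, ENNReal.mul_rpow_of_nonneg _ _ hs.le,
        mul_mul_mul_comm]
      gcongr
      exact H x y)
  have key2 := (ENNReal.geom_mean_le_arith_mean2_weighted ht hs hts _ _).trans key
  rw [lintegral_const_mul _ hf, lintegral_const_mul _ hg, lintegral_const_mul _ hh,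
    ENNReal.mul_rpow_of_nonneg _ _ ht.le, ENNReal.mul_rpow_of_nonneg _ _ hs.le,
    mul_mul_mul_comm] at key2
  refine (ENNReal.mul_le_mul_iff_right ?_ ?_).1 key2
  · simp [ENNReal.rpow_eq_zero_iff, hf1, hg1, ht.not_gt, hs.not_gt]
  · exact ENNReal.mul_ne_top (ENNReal.rpow_ne_top_of_nonneg ht.le (by simpa using hA0))
      (ENNReal.rpow_ne_top_of_nonneg hs.le (by simpa using hB0))

theorem ENNReal.tendsto_min_natCast (a : ENNReal) :
    Filter.Tendsto (fun n : ℕ => min a n) Filter.atTop (nhds a) := by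
  have := (tendsto_const_nhds (x := a)).min ENNReal.tendsto_nat_nhds_top
  simpa using this

theorem Real.prekopa_leindler {t s : ℝ} (ht : 0 < t) (hs : 0 < s) (hts : t + s = 1)
    {f g h : ℝ → ENNReal} (hf : Measurable f) (hg : Measurable g) (hh : Measurable h)
    (H : ∀ x y, f x ^ t * g y ^ s ≤ h (t * x + s * y)) :
    (∫⁻ x, f x) ^ t * (∫⁻ x, g x) ^ s ≤ ∫⁻ x, h x := by
  have hlim : ∀ F : ℝ → ENNReal, Measurable F →
      (⨆ n : ℕ, ∫⁻ x, min (F x) n) = ∫⁻ x, F x := by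
    intro F hF
    rw [← lintegral_iSup (fun n => hF.min measurable_const)
      (fun m n hmn x => min_le_min_left _ (by exact_mod_cast hmn))]
    congr 1
    ext x
    exact tendsto_nhds_unique (tendsto_atTop_iSup
      (fun m n hmn => min_le_min_left _ (by exact_mod_cast hmn)))
      (ENNReal.tendsto_min_natCast _)
  have hb : ∀ (F : ℝ → ENNReal) (n : ℕ), ⨆ x, min (F x) n ≠ ⊤ := fun F n =>
    ne_top_of_le_ne_top (ENNReal.natCast_ne_top n) (iSup_le fun x => min_le_right _ _)
  have key : ∀ n m : ℕ, (∫⁻ x, min (f x) n) ^ t * (∫⁻ x, min (g x) m) ^ s ≤ ∫⁻ x, h x := by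
    intro n m
    refine Real.prekopa_leindler_of_bounded ht hs hts (hf.min measurable_const)
      (hg.min measurable_const) hh (hb f n) (hb g m) fun x y => le_trans ?_ (H x y)
    gcongr <;> exact min_le_left _ _
  have hpow : ∀ (F : ℝ → ENNReal), Measurable F → ∀ r : ℝ, 0 < r →
      (∫⁻ x, F x) ^ r = ⨆ n : ℕ, (∫⁻ x, min (F x) n) ^ r := by
    intro F hF r hr
    rw [← hlim F hF]
    exact (ENNReal.orderIsoRpow r hr).map_iSup _
  rw [hpow f hf t ht, hpow g hg s hs, ENNReal.iSup_mul]
  refine iSup_le fun n => ?_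
  rw [ENNReal.mul_iSup]
  exact iSup_le fun m => key n m

/-- Induction by Fubini: the inequality in dimension n, applied to slices, is exactly the hypothesis
of the one-dimensional inequality for the slice integrals. -/
theorem prekopa_leindler_pi {t s : ℝ} (ht : 0 < t) (hs : 0 < s) (hts : t + s = 1) (n : ℕ) :
    ∀ {f g h : (Fin n → ℝ) → ENNReal}, Measurable f → Measurable g → Measurable h →
    (∀ x y, f x ^ t * g y ^ s ≤ h (t • x + s • y)) →
    (∫⁻ x, f x) ^ t * (∫⁻ x, g x) ^ s ≤ ∫⁻ x, h x := by
  induction n with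
  | zero =>
    intro f g h hf hg hh H
    simp only [lintegral_unique, volume_pi, Measure.pi_empty_univ, mul_one]
    exact (H _ _).trans (le_of_eq (congrArg h (Subsingleton.elim _ _)))
  | succ n ih =>
    intro f g h hf hg hh H
    let e := (MeasurableEquiv.piFinSuccAbove (fun _ : Fin (n + 1) => ℝ) 0).symm
    have he : MeasurePreserving e volume volume :=
      (volume_preserving_piFinSuccAbove (fun _ : Fin (n + 1) => ℝ) 0).symm _
    have hfub : ∀ F : (Fin (n + 1) → ℝ) → ENNReal, Measurable F →
        ∫⁻ x, F x = ∫⁻ a : ℝ, ∫⁻ y : Fin n → ℝ, F (e (a, y)) := by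
      intro F hF
      rw [← he.lintegral_comp hF, Measure.volume_eq_prod,
        lintegral_prod (fun z => F (e z)) (hF.comp e.measurable).aemeasurable]
    have hmeas : ∀ F : (Fin (n + 1) → ℝ) → ENNReal, Measurable F →
        Measurable fun a : ℝ => ∫⁻ y : Fin n → ℝ, F (e (a, y)) := fun F hF =>
      (hF.comp e.measurable).lintegral_prod_right'
    have hlin : ∀ (a b : ℝ) (x y : Fin n → ℝ),
        e (t * a + s * b, t • x + s • y) = t • e (a, x) + s • e (b, y) := by
      intro a b x y
      ext i
      refine Fin.cases ?_ (fun j => ?_) i <;> simp [e, MeasurableEquiv.piFinSuccAbove]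
    rw [hfub f hf, hfub g hg, hfub h hh]
    refine Real.prekopa_leindler ht hs hts (hmeas f hf) (hmeas g hg) (hmeas h hh) fun a b => ?_
    have hsec : ∀ a : ℝ, Measurable fun y : Fin n → ℝ => e (a, y) := fun a =>
      e.measurable.comp (by fun_prop)
    refine ih (hf.comp (hsec a)) (hg.comp (hsec b)) (hh.comp (hsec _)) fun x y => ?_
    simp only [hlin]
    exact H _ _

theorem EuclideanSpace.prekopa_leindler {t s : ℝ} (ht : 0 < t) (hs : 0 < s) (hts : t + s = 1)
    {n : ℕ} {f g h : EuclideanSpace ℝ (Fin n) → ENNReal} (hf : Measurable f) (hg : Measurable g)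
    (hh : Measurable h) (H : ∀ x y, f x ^ t * g y ^ s ≤ h (t • x + s • y)) :
    (∫⁻ x, f x) ^ t * (∫⁻ x, g x) ^ s ≤ ∫⁻ x, h x := by
  have he := PiLp.volume_preserving_toLp (Fin n)
  rw [← he.lintegral_comp hf, ← he.lintegral_comp hg, ← he.lintegral_comp hh]
  refine prekopa_leindler_pi ht hs hts n (hf.comp he.measurable) (hg.comp he.measurable)
    (hh.comp he.measurable) fun x y => ?_
  simpa using H (WithLp.toLp 2 x) (WithLp.toLp 2 y)

/-! ### Uniform convexity of |x|^p. -/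

theorem Real.rpow_arith_mean2_le {t s a b p : ℝ} (ht : 0 ≤ t) (hs : 0 ≤ s) (hts : t + s = 1)
    (ha : 0 ≤ a) (hb : 0 ≤ b) (hp : 1 ≤ p) : (t * a + s * b) ^ p ≤ t * a ^ p + s * b ^ p := by
  simpa using (convexOn_rpow hp).2 (Set.mem_Ici.2 ha) (Set.mem_Ici.2 hb) ht hs hts

/-- Clarkson's inequality: superadditivity of u ↦ u^{p/2}, the parallelogram law, then convexity of
u^{p/2}. Both uses of the exponent need p ≥ 2. -/
theorem norm_rpow_midpoint_add_le {E : Type*} [NormedAddCommGroup E] [InnerProductSpace ℝ E]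
    {p : ℝ} (hp : 2 ≤ p) (x y : E) :
    ‖(1 / 2 : ℝ) • (x + y)‖ ^ p + ‖(1 / 2 : ℝ) • (x - y)‖ ^ p ≤ (‖x‖ ^ p + ‖y‖ ^ p) / 2 := by
  have hsq : ∀ a : ℝ, 0 ≤ a → a ^ p = (a ^ 2) ^ (p / 2) := by
    intro a ha
    rw [← Real.rpow_natCast, ← Real.rpow_mul ha]
    congr 1
    push_cast
    ring
  have hpar := parallelogram_law_with_norm ℝ x y
  have h1 : ‖(1 / 2 : ℝ) • (x + y)‖ ^ 2 + ‖(1 / 2 : ℝ) • (x - y)‖ ^ 2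
      = (1 / 2) * ‖x‖ ^ 2 + (1 / 2) * ‖y‖ ^ 2 := by
    rw [norm_smul, norm_smul, Real.norm_of_nonneg (by norm_num : (0 : ℝ) ≤ 1 / 2)]
    linarith
  rw [hsq _ (norm_nonneg _), hsq _ (norm_nonneg _), hsq ‖x‖ (norm_nonneg _),
    hsq ‖y‖ (norm_nonneg _)]
  refine (Real.add_rpow_le_rpow_add (by positivity) (by positivity) (by linarith)).trans ?_
  rw [h1]
  refine (Real.rpow_arith_mean2_le (by norm_num) (by norm_num) (by norm_num) (by positivity)
    (by positivity) (by linarith : (1 : ℝ) ≤ p / 2)).trans ?_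
  linarith

theorem norm_rpow_convex_comb_le {E : Type*} [NormedAddCommGroup E] [NormedSpace ℝ E]
    {p : ℝ} (hp : 1 ≤ p) {t s : ℝ} (ht : 0 ≤ t) (hs : 0 ≤ s) (hts : t + s = 1) (x y : E) :
    ‖t • x + s • y‖ ^ p ≤ t * ‖x‖ ^ p + s * ‖y‖ ^ p := by
  refine (Real.rpow_le_rpow (norm_nonneg _) (norm_add_le _ _) (by linarith)).trans ?_
  rw [norm_smul, norm_smul, Real.norm_of_nonneg ht, Real.norm_of_nonneg hs]
  exact Real.rpow_arith_mean2_le ht hs hts (norm_nonneg _) (norm_nonneg _) hp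

/-- The point (1-s)x + sy divides the segment from x to the midpoint with weights 1-2s and 2s. Plain
convexity there, plus 2s times the midpoint gain, gives the deficit, linear in s. -/
theorem norm_rpow_uniformly_convex {E : Type*} [NormedAddCommGroup E] [InnerProductSpace ℝ E]
    {p : ℝ} (hp : 2 ≤ p) {s : ℝ} (hs : 0 ≤ s) (hs2 : s ≤ 1 / 2) (x y : E) :
    ‖(1 - s) • x + s • y‖ ^ p ≤
      (1 - s) * ‖x‖ ^ p + s * ‖y‖ ^ p - 2 * (1 / 2) ^ p * s * ‖x - y‖ ^ p := by
  have h1 := norm_rpow_convex_comb_le (by linarith : 1 ≤ p) (by linarith : 0 ≤ 1 - 2 * s)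
    (by linarith : 0 ≤ 2 * s) (by ring) x ((1 / 2 : ℝ) • (x + y))
  have h2 := norm_rpow_midpoint_add_le hp x y
  have h3 : (1 - 2 * s) • x + (2 * s) • ((1 / 2 : ℝ) • (x + y)) = (1 - s) • x + s • y := by
    module
  rw [h3] at h1
  rw [norm_smul (1 / 2 : ℝ) (x - y), Real.norm_of_nonneg (by norm_num : (0 : ℝ) ≤ 1 / 2),
    Real.mul_rpow (by norm_num) (norm_nonneg _)] at h2
  nlinarith [mul_le_mul_of_nonneg_left h2 (by linarith : 0 ≤ 2 * s)]

/-! ### First-order growth of g by Young's inequality. -/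

theorem Real.exists_young_const {p q : ℝ} (hpq : p.HolderConjugate q) {κ : ℝ} (hκ : 0 < κ) :
    ∃ C : ℝ, 0 < C ∧ ∀ l r : ℝ, 0 ≤ l → 0 ≤ r → l * r ≤ κ * r ^ p + C * l ^ q := by
  have hp := hpq.pos
  have hq := hpq.symm.pos
  set a : ℝ := (κ * p) ^ (1 / p) with ha
  have ha0 : 0 < a := by positivity
  have hap : a ^ p = κ * p := by
    rw [ha, ← Real.rpow_mul (by positivity), one_div_mul_cancel hp.ne', Real.rpow_one]
  refine ⟨(a⁻¹) ^ q / q, by positivity, fun l r hl hr => ?_⟩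
  have := Real.young_inequality_of_nonneg (mul_nonneg ha0.le hr)
    (mul_nonneg (inv_nonneg.2 ha0.le) hl) hpq
  rw [Real.mul_rpow ha0.le hr, Real.mul_rpow (inv_nonneg.2 ha0.le) hl, hap] at this
  calc l * r = a * r * (a⁻¹ * l) := by field_simp
    _ ≤ _ := this
    _ = _ := by field_simp

/-- Controls the sup-convolution of g with cost κ|w|^p to first order, uniformly in z. For large w
the cost beats the Lipschitz bound; for bounded w the gradient is nearly constant along the segment
and Young's inequality applies. -/
theorem HasCompactSupport.exists_forall_le_add_mul {E : Type*} [NormedAddCommGroup E]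
    [NormedSpace ℝ E] [FiniteDimensional ℝ E] {g : E → ℝ} (hg : ContDiff ℝ 1 g)
    (hgc : HasCompactSupport g) {p q : ℝ} (hp : 2 ≤ p) {κ C : ℝ} (hκ : 0 < κ) (hC : 0 ≤ C)
    (hY : ∀ l r : ℝ, 0 ≤ l → 0 ≤ r → l * r ≤ κ * r ^ p + C * l ^ q) {ε : ℝ} (hε : 0 < ε) :
    ∃ s₀ : ℝ, 0 < s₀ ∧ ∀ s : ℝ, 0 < s → s ≤ s₀ → ∀ z w : E,
      g (z + s • w) ≤ g z + s * (C * ‖fderiv ℝ g z‖ ^ q + ε + κ * ‖w‖ ^ p) := by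
  have hcont : Continuous (fderiv ℝ g) := hg.continuous_fderiv one_ne_zero
  have hcs : HasCompactSupport (fderiv ℝ g) := hgc.fderiv ℝ
  obtain ⟨L, hL⟩ := hcs.exists_bound_of_continuous hcont
  have hdiff : Differentiable ℝ g := hg.differentiable one_ne_zero
  -- For |w| ≥ W, L|w| ≤ κ|w|² ≤ κ|w|^p: the first step uses W ≥ L/κ, the second W ≥ 1 and p ≥ 2.
  set W : ℝ := max 1 (L / κ) with hW
  have hW1 : 1 ≤ W := le_max_left _ _
  have hWL : L ≤ κ * W := by
    have : L / κ ≤ W := le_max_right _ _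
    rwa [div_le_iff₀ hκ, mul_comm] at this
  have hW0 : 0 < W := by linarith
  obtain ⟨δ, hδ, hδ'⟩ := Metric.uniformContinuous_iff.1
    (hcs.uniformContinuous_of_continuous hcont) (ε / W) (by positivity)
  -- Keeps s|w| ≤ δ/2 when |w| ≤ W; the gradient then varies by less than ε/W, costing at most sε.
  refine ⟨δ / (2 * W), by positivity, fun s hs hss z w => ?_⟩
  have hsw : ‖z + s • w - z‖ = s * ‖w‖ := by
    rw [add_sub_cancel_left, norm_smul, Real.norm_of_nonneg hs.le]
  have hnn : 0 ≤ C * ‖fderiv ℝ g z‖ ^ q := by positivity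
  rcases le_total W ‖w‖ with hw | hw
  · have h1 := Convex.norm_image_sub_le_of_norm_fderiv_le (𝕜 := ℝ) (f := g) (s := Set.univ)
      (fun x _ => hdiff x) (fun x _ => hL x) convex_univ (Set.mem_univ z)
      (Set.mem_univ (z + s • w))
    rw [hsw] at h1
    have h2 := (le_abs_self _).trans h1
    have hw1 : 1 ≤ ‖w‖ := hW1.trans hw
    have h3 : ‖w‖ * ‖w‖ ≤ ‖w‖ ^ p := by
      rw [← pow_two, ← Real.rpow_natCast]
      exact Real.rpow_le_rpow_of_exponent_le hw1 (by exact_mod_cast hp)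
    have h4 : L * ‖w‖ ≤ κ * ‖w‖ ^ p := by
      calc L * ‖w‖ ≤ (κ * W) * ‖w‖ := by gcongr
        _ ≤ (κ * ‖w‖) * ‖w‖ := by gcongr
        _ = κ * (‖w‖ * ‖w‖) := by ring
        _ ≤ _ := by gcongr
    nlinarith [mul_le_mul_of_nonneg_left h4 hs.le, mul_nonneg hs.le hnn, mul_pos hs hε]
  · have h1 : ∀ x ∈ Metric.closedBall z (s * ‖w‖), ‖fderiv ℝ g x‖ ≤ ‖fderiv ℝ g z‖ + ε / W := by
      intro x hx
      have hx' : dist x z < δ := by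
        refine (Metric.mem_closedBall.1 hx).trans_lt ?_
        calc s * ‖w‖ ≤ δ / (2 * W) * W := by gcongr
          _ = δ / 2 := by field_simp
          _ < δ := by linarith
      have := hδ' hx'
      rw [dist_eq_norm] at this
      linarith [norm_le_norm_add_norm_sub' (fderiv ℝ g x) (fderiv ℝ g z)]
    have h2 := Convex.norm_image_sub_le_of_norm_fderiv_le (𝕜 := ℝ) (f := g)
      (fun x _ => hdiff x) h1 (convex_closedBall _ _)
      (Metric.mem_closedBall_self (by positivity))
      (by rw [Metric.mem_closedBall, dist_eq_norm, hsw] : z + s • w ∈ _)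
    rw [hsw] at h2
    have h3 := (le_abs_self _).trans h2
    have h4 := hY ‖fderiv ℝ g z‖ ‖w‖ (norm_nonneg _) (norm_nonneg _)
    have h5 : ε / W * ‖w‖ ≤ ε := by
      calc ε / W * ‖w‖ ≤ ε / W * W := by gcongr
        _ = ε := by field_simp
    nlinarith [mul_le_mul_of_nonneg_left h4 hs.le, mul_le_mul_of_nonneg_left h5 hs.le]

/-! ### Entropy as a derivative at s = 0. -/

/-- A tangent-line bound: s ↦ (1-s) log ∫ e^{G/(1-s)} is convex, being a perspective of the
log-Laplace transform, with slope Ent(e^G)/∫e^G at 0. The proof is direct, from e^u ≥ 1 + u. -/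
theorem Real.log_integral_exp_add_le {α : Type*} [MeasurableSpace α] {μ : Measure α}
    [IsProbabilityMeasure μ] {G : α → ℝ} (hG : Measurable G) {K : ℝ} (hGK : ∀ x, |G x| ≤ K)
    {s : ℝ} (hs1 : s < 1) :
    Real.log (∫ x, Real.exp (G x) ∂μ) +
      s * ((∫ x, Real.exp (G x) * (G x - Real.log (∫ y, Real.exp (G y) ∂μ)) ∂μ) /
        ∫ x, Real.exp (G x) ∂μ) ≤
      (1 - s) * Real.log (∫ x, Real.exp (G x / (1 - s)) ∂μ) := by
  have ht : 0 < 1 - s := by linarith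
  have hint : ∀ r : ℝ, Integrable (fun x => Real.exp (r * G x)) μ := fun r =>
    Integrable.of_bound (by fun_prop) (Real.exp (|r| * K)) (.of_forall fun x => by
      rw [Real.norm_of_nonneg (Real.exp_pos _).le]
      refine Real.exp_le_exp.2 ((le_abs_self _).trans ?_)
      rw [abs_mul]
      gcongr
      exact hGK x)
  have hi1 : Integrable (fun x => Real.exp (G x)) μ := by simpa using hint 1
  have hi2 : Integrable (fun x => Real.exp (G x / (1 - s))) μ := by
    simpa [div_eq_inv_mul] using hint (1 - s)⁻¹
  have hi3 : Integrable (fun x => Real.exp (G x) * G x) μ :=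
    hi1.mul_bdd (c := K) (by fun_prop) (.of_forall hGK)
  set m := ∫ x, Real.exp (G x) ∂μ with hm
  have hm0 : 0 < m := integral_exp_pos hi1
  set A := ∫ x, Real.exp (G x) * G x ∂μ with hA
  have hE : ∫ x, Real.exp (G x) * (G x - Real.log m) ∂μ = A - m * Real.log m := by
    simp only [mul_sub]
    rw [integral_sub hi3 (hi1.mul_const _), integral_mul_const]
  -- The mean of sG/(1-s) under the probability e^G μ / m, so the linear terms cancel on
  -- integration.
  set c := s / (1 - s) * (A / m) with hc
  have hlow : Real.exp c * m ≤ ∫ x, Real.exp (G x / (1 - s)) ∂μ := by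
    have hpt : ∀ x, Real.exp c * ((1 - c) * Real.exp (G x) +
        s / (1 - s) * (Real.exp (G x) * G x)) ≤ Real.exp (G x / (1 - s)) := by
      intro x
      have h1 : G x / (1 - s) = c + G x + (s / (1 - s) * G x - c) := by
        field_simp
        ring
      rw [h1, Real.exp_add, Real.exp_add]
      have := Real.add_one_le_exp (s / (1 - s) * G x - c)
      calc _ = Real.exp c * Real.exp (G x) * (s / (1 - s) * G x - c + 1) := by ring
        _ ≤ _ := by gcongr
    refine le_trans (le_of_eq ?_) (integral_mono
      (((hi1.const_mul _).add (hi3.const_mul _)).const_mul _) hi2 hpt)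
    rw [integral_const_mul]
    congr 1
    simp only [Pi.add_apply]
    rw [integral_add (hi1.const_mul _) (hi3.const_mul _), integral_const_mul, integral_const_mul,
      ← hm, ← hA, hc]
    field_simp
    ring
  have h2 := Real.log_le_log (by positivity) hlow
  rw [Real.log_mul (Real.exp_pos _).ne' hm0.ne', Real.log_exp] at h2
  rw [hE]
  refine le_trans (le_of_eq ?_) (mul_le_mul_of_nonneg_left h2 ht.le)
  rw [hc]
  field_simp
  ring

/-- The tangent bound minorises the left side of `hle`, and e^{sH} ≤ 1 + sH + (sH)² majorises the
right. Dividing by s leaves Ent ≤ A + sB, and s → 0. -/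
theorem MeasureTheory.entropy_exp_le_of_rpow_integral_le {α : Type*} [MeasurableSpace α]
    {μ : Measure α} [IsProbabilityMeasure μ] {G H : α → ℝ} (hG : Measurable G) {K : ℝ}
    (hGK : ∀ x, |G x| ≤ K) (hH : Measurable H) {M : ℝ} (hHM : ∀ x, |H x| ≤ M) {s₀ : ℝ}
    (hs₀ : 0 < s₀)
    (hle : ∀ s, 0 < s → s < 1 → s ≤ s₀ →
      (∫ x, Real.exp (G x / (1 - s)) ∂μ) ^ (1 - s) ≤ ∫ x, Real.exp (G x + s * H x) ∂μ) :
    ∫ x, Real.exp (G x) * (G x - Real.log (∫ y, Real.exp (G y) ∂μ)) ∂μ ≤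
      ∫ x, H x * Real.exp (G x) ∂μ := by
  have hbd : ∀ (F : α → ℝ) (R : ℝ), Measurable F → (∀ x, |F x| ≤ R) →
      Integrable (fun x => Real.exp (F x)) μ := fun F R hF hFR =>
    Integrable.of_bound (by fun_prop) (Real.exp R) (.of_forall fun x => by
      rw [Real.norm_of_nonneg (Real.exp_pos _).le]
      exact Real.exp_le_exp.2 ((le_abs_self _).trans (hFR x)))
  have hi1 := hbd G K hG hGK
  have hi2 : Integrable (fun x => H x * Real.exp (G x)) μ :=
    hi1.bdd_mul (c := M) (by fun_prop) (.of_forall hHM)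
  have hi3 : Integrable (fun x => H x ^ 2 * Real.exp (G x)) μ :=
    hi1.bdd_mul (c := M ^ 2) (by fun_prop) (.of_forall fun x => by
      rw [norm_pow]
      exact pow_le_pow_left₀ (norm_nonneg _) (hHM x) 2)
  set m := ∫ x, Real.exp (G x) ∂μ with hm
  have hm0 : 0 < m := integral_exp_pos hi1
  set A := ∫ x, H x * Real.exp (G x) ∂μ with hA
  set B := ∫ x, H x ^ 2 * Real.exp (G x) ∂μ with hB
  set E := ∫ x, Real.exp (G x) * (G x - Real.log m) ∂μ with hE
  have hM0 : 0 ≤ M := by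
    obtain ⟨x⟩ := nonempty_of_isProbabilityMeasure μ
    exact (abs_nonneg _).trans (hHM x)
  have key : ∀ s, 0 < s → s < 1 → s ≤ s₀ → s * M ≤ 1 → E ≤ A + s * B := by
    intro s hs hs1 hss hsM
    have h1 := Real.log_integral_exp_add_le (μ := μ) hG hGK hs1
    rw [← hm, ← hE] at h1
    have hi4 := hbd (fun x => G x / (1 - s)) (K / (1 - s)) (by fun_prop) fun x => by
      rw [abs_div, abs_of_pos (by linarith : 0 < 1 - s)]
      have := hGK x
      gcongr
    have hi5 := hbd (fun x => G x + s * H x) (K + s * M) (by fun_prop) fun x => by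
      refine (abs_add_le _ _).trans ?_
      rw [abs_mul, abs_of_pos hs]
      have := hGK x
      have := hHM x
      gcongr
    have h2 := Real.log_le_log (Real.rpow_pos_of_pos (integral_exp_pos hi4) _) (hle s hs hs1 hss)
    rw [Real.log_rpow (integral_exp_pos hi4)] at h2
    have h3 : ∫ x, Real.exp (G x + s * H x) ∂μ ≤ m + s * A + s ^ 2 * B := by
      have hpt : ∀ x, Real.exp (G x + s * H x) ≤
          Real.exp (G x) + s * (H x * Real.exp (G x)) + s ^ 2 * (H x ^ 2 * Real.exp (G x)) := by
        intro x
        have h4 : |s * H x| ≤ 1 := by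
          rw [abs_mul, abs_of_pos hs]
          exact (mul_le_mul_of_nonneg_left (hHM x) hs.le).trans hsM
        have h5 := (abs_le.1 (Real.abs_exp_sub_one_sub_id_le h4)).2
        rw [Real.exp_add]
        calc _ ≤ Real.exp (G x) * (1 + s * H x + (s * H x) ^ 2) := by
              gcongr
              linarith
          _ = _ := by ring
      refine (integral_mono hi5 ((hi1.add (hi2.const_mul _)).add (hi3.const_mul _)) hpt).trans
        (le_of_eq ?_)
      rw [integral_add' (hi1.add (hi2.const_mul _)) (hi3.const_mul _),
        integral_add' hi1 (hi2.const_mul _), integral_const_mul, integral_const_mul]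
    have h4 : Real.log (∫ x, Real.exp (G x + s * H x) ∂μ) ≤
        Real.log m + (s * A + s ^ 2 * B) / m := by
      have hp := integral_exp_pos hi5
      rw [← sub_le_iff_le_add', ← Real.log_div hp.ne' hm0.ne']
      refine (Real.log_le_sub_one_of_pos (by positivity)).trans ?_
      rw [div_sub_one hm0.ne']
      gcongr
      linarith
    have h5 : s * (E / m) ≤ (s * A + s ^ 2 * B) / m := by linarith
    rw [← mul_div_assoc, div_le_div_iff_of_pos_right hm0] at h5
    nlinarith
  have hlim : Filter.Tendsto (fun s : ℝ => A + s * B) (nhdsWithin 0 (Set.Ioi 0)) (nhds A) := by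
    have : Filter.Tendsto (fun s : ℝ => A + s * B) (nhds 0) (nhds (A + 0 * B)) :=
      (by fun_prop : Continuous fun s : ℝ => A + s * B).tendsto 0
    simpa using this.mono_left nhdsWithin_le_nhds
  refine ge_of_tendsto hlim ?_
  -- The bound 1/(M+1) gives sM ≤ 1 even when M = 0.
  have hpos : 0 < min (1 / 2) (min s₀ (1 / (M + 1))) := by positivity
  filter_upwards [Ioc_mem_nhdsGT hpos] with s hs
  obtain ⟨hs0, hs1⟩ := hs
  have h1 : s ≤ 1 / 2 := hs1.trans (min_le_left _ _)
  have h2 : s ≤ s₀ := hs1.trans ((min_le_right _ _).trans (min_le_left _ _))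
  have h3 : s ≤ 1 / (M + 1) := hs1.trans ((min_le_right _ _).trans (min_le_right _ _))
  refine key s hs0 (by linarith) h2 ?_
  rw [le_div_iff₀ (by linarith)] at h3
  nlinarith

/-! ### Gibbs measures and compactly supported g. -/

namespace ModifiedLogSobolev

theorem isProbabilityMeasure_gibbs {n : ℕ} {Φ : EuclideanSpace ℝ (Fin n) → ℝ}
    (hΦ : Integrable fun x => Real.exp (-Φ x)) : IsProbabilityMeasure (gibbs Φ) := by
  have hZ : 0 < ∫ x, Real.exp (-Φ x) := integral_exp_pos hΦ
  refine ⟨?_⟩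
  rw [gibbs, withDensity_apply _ MeasurableSet.univ, Measure.restrict_univ,
    ← ofReal_integral_eq_lintegral_ofReal (hΦ.div_const _) (.of_forall fun x => by positivity),
    integral_div, div_self hZ.ne', ENNReal.ofReal_one]

theorem lintegral_gibbs {n : ℕ} {Φ : EuclideanSpace ℝ (Fin n) → ℝ} (hΦ : Measurable Φ)
    {F : EuclideanSpace ℝ (Fin n) → ℝ} (hF : Measurable F) :
    ∫⁻ x, ENNReal.ofReal (Real.exp (F x)) ∂(gibbs Φ) =
      ∫⁻ x, ENNReal.ofReal (Real.exp (F x - Φ x) / ∫ y, Real.exp (-Φ y)) := by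
  rw [gibbs, lintegral_withDensity_eq_lintegral_mul _ (by fun_prop) (by fun_prop)]
  refine lintegral_congr fun x => ?_
  have hZ : 0 ≤ ∫ y, Real.exp (-Φ y) := integral_nonneg fun y => (Real.exp_pos _).le
  rw [Pi.mul_apply, ← ENNReal.ofReal_mul (by positivity), sub_eq_add_neg, Real.exp_add]
  congr 1
  ring

/-- Prékopa–Leindler with the Gibbs density itself as second function: its integral is 1, and the
powers of Z cancel since t + s = 1. -/
theorem rpow_integral_gibbs_le {n : ℕ} {Φ : EuclideanSpace ℝ (Fin n) → ℝ}
    (hΦ : Measurable Φ) (hΦi : Integrable fun x => Real.exp (-Φ x))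
    {t s : ℝ} (ht : 0 < t) (hs : 0 < s) (hts : t + s = 1)
    {u v : EuclideanSpace ℝ (Fin n) → ℝ} (hu : Measurable u) (hv : Measurable v)
    (hui : Integrable (fun x => Real.exp (u x)) (gibbs Φ))
    (hvi : Integrable (fun x => Real.exp (v x)) (gibbs Φ))
    (H : ∀ x y, t * u x + Φ (t • x + s • y) ≤ v (t • x + s • y) + t * Φ x + s * Φ y) :
    (∫ x, Real.exp (u x) ∂(gibbs Φ)) ^ t ≤ ∫ x, Real.exp (v x) ∂(gibbs Φ) := by
  have := isProbabilityMeasure_gibbs hΦi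
  set Z := ∫ y, Real.exp (-Φ y) with hZd
  have hZ : 0 < Z := integral_exp_pos hΦi
  have h1 := lintegral_gibbs hΦ hu
  have h2 := lintegral_gibbs hΦ (measurable_const (a := (0 : ℝ)))
  have h3 := lintegral_gibbs hΦ hv
  simp only [Real.exp_zero, ENNReal.ofReal_one, lintegral_const, measure_univ, mul_one] at h2
  have key := EuclideanSpace.prekopa_leindler ht hs hts
    (f := fun x => ENNReal.ofReal (Real.exp (u x - Φ x) / Z))
    (g := fun x => ENNReal.ofReal (Real.exp (0 - Φ x) / Z))
    (h := fun x => ENNReal.ofReal (Real.exp (v x - Φ x) / Z))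
    (by fun_prop) (by fun_prop) (by fun_prop) (by
      intro x y
      rw [ENNReal.ofReal_rpow_of_nonneg (by positivity) ht.le,
        ENNReal.ofReal_rpow_of_nonneg (by positivity) hs.le,
        ← ENNReal.ofReal_mul (by positivity)]
      refine ENNReal.ofReal_le_ofReal ?_
      rw [Real.div_rpow (by positivity) hZ.le, Real.div_rpow (by positivity) hZ.le,
        div_mul_div_comm, ← Real.rpow_add hZ, hts, Real.rpow_one, ← Real.exp_mul, ← Real.exp_mul,
        ← Real.exp_add]
      gcongr
      linarith [H x y])
  rw [← h1, ← h2, ← h3, ENNReal.one_rpow, mul_one,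
    ← ofReal_integral_eq_lintegral_ofReal hui (.of_forall fun x => (Real.exp_pos _).le),
    ← ofReal_integral_eq_lintegral_ofReal hvi (.of_forall fun x => (Real.exp_pos _).le),
    ENNReal.ofReal_rpow_of_nonneg (integral_nonneg fun x => (Real.exp_pos _).le) ht.le] at key
  exact (ENNReal.ofReal_le_ofReal_iff (integral_nonneg fun x => (Real.exp_pos _).le)).1 key

theorem entropy_le_of_hasCompactSupport {n : ℕ} {Φ : EuclideanSpace ℝ (Fin n) → ℝ}
    (hΦ : Measurable Φ) (hΦi : Integrable fun x => Real.exp (-Φ x)) {p q κ C : ℝ} (hp : 2 ≤ p)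
    (hq : 0 ≤ q) (hκ : 0 < κ) (hC : 0 ≤ C)
    (hY : ∀ l r : ℝ, 0 ≤ l → 0 ≤ r → l * r ≤ κ * r ^ p + C * l ^ q)
    (hconv : ∀ s : ℝ, 0 ≤ s → s ≤ 1 / 2 → ∀ x y,
      Φ ((1 - s) • x + s • y) ≤ (1 - s) * Φ x + s * Φ y - κ * s * ‖x - y‖ ^ p)
    {g : EuclideanSpace ℝ (Fin n) → ℝ} (hg : ContDiff ℝ 1 g) (hgc : HasCompactSupport g) :
    ∫ x, Real.exp (g x) * (g x - Real.log (∫ y, Real.exp (g y) ∂(gibbs Φ))) ∂(gibbs Φ) ≤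
      C * ∫ x, ‖fderiv ℝ g x‖ ^ q * Real.exp (g x) ∂(gibbs Φ) := by
  have := isProbabilityMeasure_gibbs hΦi
  have hcont : Continuous (fderiv ℝ g) := hg.continuous_fderiv one_ne_zero
  obtain ⟨K, hK⟩ := hgc.exists_bound_of_continuous hg.continuous
  obtain ⟨L, hL⟩ := (hgc.fderiv ℝ).exists_bound_of_continuous hcont
  have hgm : Measurable g := hg.continuous.measurable
  have hdm : Measurable fun x => ‖fderiv ℝ g x‖ ^ q := by
    have := hcont.norm.measurable
    fun_prop
  have hdb : ∀ x, |‖fderiv ℝ g x‖ ^ q| ≤ L ^ q := fun x => by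
    rw [abs_of_nonneg (by positivity)]
    exact Real.rpow_le_rpow (norm_nonneg _) (hL x) hq
  have hi1 : Integrable (fun x => Real.exp (g x)) (gibbs Φ) :=
    Integrable.of_bound (by fun_prop) (Real.exp K) (.of_forall fun x => by
      rw [Real.norm_of_nonneg (Real.exp_pos _).le]
      exact Real.exp_le_exp.2 ((le_abs_self _).trans (hK x)))
  have hi2 : Integrable (fun x => ‖fderiv ℝ g x‖ ^ q * Real.exp (g x)) (gibbs Φ) :=
    hi1.bdd_mul (c := L ^ q) (by fun_prop) (.of_forall hdb)
  have key : ∀ ε : ℝ, 0 < ε →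
      ∫ x, Real.exp (g x) * (g x - Real.log (∫ y, Real.exp (g y) ∂(gibbs Φ))) ∂(gibbs Φ) ≤
        C * (∫ x, ‖fderiv ℝ g x‖ ^ q * Real.exp (g x) ∂(gibbs Φ)) +
          ε * ∫ x, Real.exp (g x) ∂(gibbs Φ) := by
    intro ε hε
    obtain ⟨s₀, hs₀, hs⟩ := hgc.exists_forall_le_add_mul hg hp hκ hC hY hε
    have hHm : Measurable fun x => C * ‖fderiv ℝ g x‖ ^ q + ε := by fun_prop
    have hHb : ∀ x, |C * ‖fderiv ℝ g x‖ ^ q + ε| ≤ C * L ^ q + ε := fun x => by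
      rw [abs_of_nonneg (by positivity)]
      have := (le_abs_self _).trans (hdb x)
      gcongr
    refine (entropy_exp_le_of_rpow_integral_le (μ := gibbs Φ) hgm hK hHm hHb
      (lt_min hs₀ (by norm_num : (0 : ℝ) < 1 / 2)) ?_).trans (le_of_eq ?_)
    · intro s hs0 hs1 hss
      have hss₀ := hss.trans (min_le_left _ _)
      have hs2 := hss.trans (min_le_right _ _)
      have ht : 0 < 1 - s := by linarith
      refine rpow_integral_gibbs_le hΦ hΦi ht hs0 (by ring) (by fun_prop) (by fun_prop) ?_ ?_ ?_
      · refine Integrable.of_bound (by fun_prop) (Real.exp (K / (1 - s))) (.of_forall fun x => ?_)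
        rw [Real.norm_of_nonneg (Real.exp_pos _).le]
        refine Real.exp_le_exp.2 ?_
        have := (le_abs_self _).trans (hK x)
        gcongr
      · refine Integrable.of_bound (by fun_prop) (Real.exp (K + s * (C * L ^ q + ε)))
          (.of_forall fun x => ?_)
        rw [Real.norm_of_nonneg (Real.exp_pos _).le]
        refine Real.exp_le_exp.2 ?_
        have := (le_abs_self _).trans (hK x)
        have := (le_abs_self _).trans (hHb x)
        gcongr
      · intro x y
        have h1 := hconv s hs0.le hs2 x y
        -- Base point z = (1-s)x + sy and direction w = x - y, so z + sw = x; the terms κs|x-y|^p in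
        -- `h1` and `h2` cancel.
        have h2 := hs s hs0 hss₀ ((1 - s) • x + s • y) (x - y)
        have h3 : (1 - s) • x + s • y + s • (x - y) = x := by module
        rw [h3] at h2
        rw [mul_div_cancel₀ _ ht.ne']
        linarith
    · rw [← integral_const_mul, ← integral_const_mul, ← integral_add (hi2.const_mul _)
        (hi1.const_mul _)]
      congr 1
      ext x
      ring
  refine le_of_forall_pos_le_add fun δ hδ => ?_
  have hm := integral_exp_pos hi1
  refine (key (δ / ∫ x, Real.exp (g x) ∂(gibbs Φ)) (by positivity)).trans (le_of_eq ?_)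
  rw [div_mul_cancel₀ _ hm.ne']

/-! ### Passage to general g by approximation. -/

/-- The entropy integrand changes sign. Adding m - f, of zero integral when m = ∫f, makes it
nonnegative, as Fatou's lemma requires. -/
theorem entIntegrand_sub_add_nonneg {f m : ℝ} (hf : 0 < f) (hm : 0 < m) :
    0 ≤ f * Real.log (f / m) - f + m := by
  have := Real.one_sub_inv_le_log_of_pos (by positivity : 0 < f / m)
  have h2 := mul_le_mul_of_nonneg_left this hf.le
  rw [inv_div, mul_sub, mul_one, mul_div_cancel₀ _ hf.ne'] at h2
  linarith

theorem integrable_entIntegrand_and_ent_le_of_tendsto {α : Type*} [MeasurableSpace α]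
    {μ : Measure α} [IsProbabilityMeasure μ] {f : α → ℝ} {fk : ℕ → α → ℝ} {I : ℝ} {Ik : ℕ → ℝ}
    (hf : Integrable f μ) (hf0 : ∀ x, 0 < f x)
    (hfk : ∀ k, Integrable (fk k) μ) (hfk0 : ∀ k x, 0 < fk k x)
    (hlim : ∀ x, Filter.Tendsto (fun k => fk k x) Filter.atTop (nhds (f x)))
    (hint : Filter.Tendsto (fun k => ∫ x, fk k x ∂μ) Filter.atTop (nhds (∫ x, f x ∂μ)))
    (hent : ∀ k, Integrable (entIntegrand μ (fk k)) μ) (hle : ∀ k, ent μ (fk k) ≤ Ik k)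
    (hI : Filter.Tendsto Ik Filter.atTop (nhds I)) :
    Integrable (entIntegrand μ f) μ ∧ ent μ f ≤ I := by
  have hpos : ∀ F : α → ℝ, Integrable F μ → (∀ x, 0 < F x) → 0 < ∫ x, F x ∂μ := by
    intro F hF hF0
    rw [integral_pos_iff_support_of_nonneg (fun x => (hF0 x).le) hF]
    have : Function.support F = Set.univ := Set.eq_univ_of_forall fun x => (hF0 x).ne'
    simp [this]
  have hm := hpos f hf hf0
  have hmk := fun k => hpos (fk k) (hfk k) (hfk0 k)
  let ψ : (α → ℝ) → α → ℝ := fun F x => entIntegrand μ F x - F x + ∫ y, F y ∂μ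
  have hψi : ∀ F : α → ℝ, Integrable F μ → Integrable (entIntegrand μ F) μ →
      Integrable (ψ F) μ := fun F hF hE => (hE.sub hF).add (integrable_const _)
  have hψe : ∀ F : α → ℝ, Integrable F μ → Integrable (entIntegrand μ F) μ →
      ∫ x, ψ F x ∂μ = ent μ F := by
    intro F hF hE
    refine (integral_add (hE.sub hF) (integrable_const _)).trans ?_
    rw [integral_sub' hE hF]
    simp [ent]
  have hψ0 : ∀ x, 0 ≤ ψ f x := fun x => entIntegrand_sub_add_nonneg (hf0 x) hm
  have hψk0 : ∀ k x, 0 ≤ ψ (fk k) x := fun k x => entIntegrand_sub_add_nonneg (hfk0 k x) (hmk k)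
  have hψlim : ∀ x, Filter.Tendsto (fun k => ψ (fk k) x) Filter.atTop (nhds (ψ f x)) := fun x =>
    (((hlim x).mul (((hlim x).div hint hm.ne').log (div_pos (hf0 x) hm).ne')).sub (hlim x)).add hint
  have hψm : AEStronglyMeasurable (ψ f) μ := by
    refine aestronglyMeasurable_of_tendsto_ae Filter.atTop (fun k => (hψi _ (hfk k) (hent k)).1)
      (.of_forall hψlim)
  have hfatou : ∫⁻ x, ENNReal.ofReal (ψ f x) ∂μ ≤ ENNReal.ofReal I := by
    have h1 : ∀ x, ENNReal.ofReal (ψ f x) =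
        Filter.liminf (fun k => ENNReal.ofReal (ψ (fk k) x)) Filter.atTop := fun x =>
      ((ENNReal.tendsto_ofReal (hψlim x)).liminf_eq).symm
    simp_rw [h1]
    refine (lintegral_liminf_le' fun k =>
      (hψi _ (hfk k) (hent k)).1.aemeasurable.ennreal_ofReal).trans ?_
    rw [← (ENNReal.tendsto_ofReal hI).liminf_eq]
    refine Filter.liminf_le_liminf (.of_forall fun k => ?_)
    rw [← ofReal_integral_eq_lintegral_ofReal (hψi _ (hfk k) (hent k)) (.of_forall (hψk0 k)),
      hψe _ (hfk k) (hent k)]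
    exact ENNReal.ofReal_le_ofReal (hle k)
  have hψint : Integrable (ψ f) μ :=
    ⟨hψm, by
      rw [hasFiniteIntegral_iff_ofReal (.of_forall hψ0)]
      exact hfatou.trans_lt ENNReal.ofReal_lt_top⟩
  have hE : Integrable (entIntegrand μ f) μ := by
    refine ((hψint.add hf).sub (integrable_const (∫ y, f y ∂μ))).congr (.of_forall fun x => ?_)
    simp only [Pi.add_apply, Pi.sub_apply, ψ]
    ring
  refine ⟨hE, ?_⟩
  have hI0 : 0 ≤ I := ge_of_tendsto' hI fun k => (integral_nonneg (hψk0 k)).trans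
    ((hψe _ (hfk k) (hent k)).le.trans (hle k))
  rw [← hψe f hf hE, ← ENNReal.ofReal_le_ofReal_iff hI0,
    ofReal_integral_eq_lintegral_ofReal hψint (.of_forall hψ0)]
  exact hfatou

theorem entIntegrand_exp {α : Type*} [MeasurableSpace α] {μ : Measure α} {g : α → ℝ}
    (hm : 0 < ∫ x, Real.exp (g x) ∂μ) (x : α) :
    entIntegrand μ (fun x => Real.exp (g x)) x =
      Real.exp (g x) * (g x - Real.log (∫ y, Real.exp (g y) ∂μ)) := by
  rw [entIntegrand, Real.log_div (Real.exp_pos _).ne' hm.ne', Real.log_exp]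

/-- The conclusion of the modified logarithmic Sobolev inequality for a single function `g`. -/
def EntropyBound {E : Type*} [NormedAddCommGroup E] [NormedSpace ℝ E] [MeasurableSpace E]
    (μ : Measure E) (q c : ℝ) (g : E → ℝ) : Prop :=
  Integrable (entIntegrand μ fun x => Real.exp (g x)) μ ∧
    ent μ (fun x => Real.exp (g x)) ≤ c * ∫ x, ‖fderiv ℝ g x‖ ^ q * Real.exp (g x) ∂μ

section Approximation

variable {E : Type*} [NormedAddCommGroup E] [InnerProductSpace ℝ E] [FiniteDimensional ℝ E]
  [MeasurableSpace E] [BorelSpace E] {μ : Measure E} [IsProbabilityMeasure μ] {q c : ℝ}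

theorem EntropyBound.of_bounded (hq : 0 ≤ q)
    (hcs : ∀ g : E → ℝ, ContDiff ℝ 1 g → HasCompactSupport g → EntropyBound μ q c g)
    {g : E → ℝ} (hg : ContDiff ℝ 1 g) {K : ℝ} (hK : ∀ x, |g x| ≤ K)
    (hgi : Integrable (fun x => ‖fderiv ℝ g x‖ ^ q * Real.exp (g x)) μ) :
    EntropyBound μ q c g := by
  let b : ContDiffBump (0 : E) := ⟨1, 2, one_pos, one_lt_two⟩
  have hbC : ContDiff ℝ 1 b := b.contDiff
  obtain ⟨B, hB⟩ := (b.hasCompactSupport.fderiv ℝ).exists_bound_of_continuous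
    (hbC.continuous_fderiv one_ne_zero)
  have hB0 : 0 ≤ B := (norm_nonneg _).trans (hB 0)
  have hK0 : 0 ≤ K := (abs_nonneg _).trans (hK 0)
  let r : ℕ → ℝ := fun k => ((k : ℝ) + 1)⁻¹
  have hr0 : ∀ k, 0 < r k := fun k => by positivity
  have hr1 : ∀ k, r k ≤ 1 := fun k => inv_le_one_of_one_le₀ (by linarith [k.cast_nonneg (α := ℝ)])
  let χ : ℕ → E → ℝ := fun k x => b (r k • x)
  have hχC : ∀ k, ContDiff ℝ 1 (χ k) := fun k => hbC.comp (contDiff_const_smul _)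
  have hχ0 : ∀ k x, 0 ≤ χ k x := fun k x => b.nonneg
  have hχ1 : ∀ k x, χ k x ≤ 1 := fun k x => b.le_one
  have hχs : ∀ k, HasCompactSupport (χ k) := fun k =>
    b.hasCompactSupport.comp_smul (hr0 k).ne'
  have hχd : ∀ k x, ‖fderiv ℝ (χ k) x‖ ≤ B := by
    intro k x
    have : fderiv ℝ (χ k) x = r k • fderiv ℝ b (r k • x) := by
      simp only [χ]
      exact fderiv_comp_smul _
    rw [this, norm_smul, Real.norm_of_nonneg (hr0 k).le]
    exact (mul_le_mul (hr1 k) (hB _) (norm_nonneg _) zero_le_one).trans (one_mul B).le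
  let G : ℕ → E → ℝ := fun k x => χ k x * g x
  have hGC : ∀ k, ContDiff ℝ 1 (G k) := fun k => (hχC k).mul hg
  have hGs : ∀ k, HasCompactSupport (G k) := fun k => (hχs k).mul_right
  have hGK : ∀ k x, |G k x| ≤ K := fun k x => by
    rw [abs_mul, abs_of_nonneg (hχ0 k x)]
    exact (mul_le_mul (hχ1 k x) (hK x) (abs_nonneg _) zero_le_one).trans (one_mul K).le
  have hGd : ∀ k x, ‖fderiv ℝ (G k) x‖ ≤ ‖fderiv ℝ g x‖ + K * B := by
    intro k x
    have : fderiv ℝ (G k) x = χ k x • fderiv ℝ g x + g x • fderiv ℝ (χ k) x :=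
      fderiv_fun_mul ((hχC k).differentiable one_ne_zero x) (hg.differentiable one_ne_zero x)
    rw [this]
    refine (norm_add_le _ _).trans ?_
    rw [norm_smul, norm_smul, Real.norm_of_nonneg (hχ0 k x)]
    refine add_le_add ?_ (mul_le_mul (hK x) (hχd k x) (norm_nonneg _) hK0)
    exact (mul_le_mul_of_nonneg_right (hχ1 k x) (norm_nonneg _)).trans (one_mul _).le
  -- Agreement on a neighbourhood, not just at x, so that derivatives agree as well.
  have hev : ∀ x, ∀ᶠ k in Filter.atTop, G k =ᶠ[nhds x] g := by
    intro x
    have h1 : Filter.Tendsto (fun k => r k * (‖x‖ + 1)) Filter.atTop (nhds (0 * (‖x‖ + 1))) := by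
      refine Filter.Tendsto.mul_const _ ?_
      simpa [r, one_div] using tendsto_one_div_add_atTop_nhds_zero_nat (𝕜 := ℝ)
    rw [zero_mul] at h1
    filter_upwards [h1.eventually_lt_const one_pos] with k hk
    filter_upwards [Metric.ball_mem_nhds x one_pos] with y hy
    have h2 : ‖y‖ ≤ ‖x‖ + 1 := by
      rw [Metric.mem_ball, dist_eq_norm] at hy
      linarith [norm_le_norm_add_norm_sub' y x]
    have h3 : χ k y = 1 := by
      refine b.one_of_mem_closedBall ?_
      rw [mem_closedBall_zero_iff, norm_smul, Real.norm_of_nonneg (hr0 k).le]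
      exact (mul_le_mul_of_nonneg_left h2 (hr0 k).le).trans hk.le
    simp [G, h3]
  have hgm : Measurable g := hg.continuous.measurable
  have hexp : ∀ F : E → ℝ, Measurable F → (∀ x, |F x| ≤ K) →
      Integrable (fun x => Real.exp (F x)) μ := fun F hF hFK =>
    Integrable.of_bound (by fun_prop) (Real.exp K) (.of_forall fun x => by
      rw [Real.norm_of_nonneg (Real.exp_pos _).le]
      exact Real.exp_le_exp.2 ((le_abs_self _).trans (hFK x)))
  -- Boundedness of g removes the weight e^g; this supplies the dominating function for the cutoff
  -- gradients.
  have hdi : Integrable (fun x => ‖fderiv ℝ g x‖ ^ q) μ := by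
    have : Integrable (fun x => Real.exp (-g x) * (‖fderiv ℝ g x‖ ^ q * Real.exp (g x))) μ :=
      hgi.bdd_mul (c := Real.exp K) (by fun_prop) (.of_forall fun x => by
        rw [Real.norm_of_nonneg (Real.exp_pos _).le]
        exact Real.exp_le_exp.2 ((neg_le_abs _).trans (hK x)))
    refine this.congr (.of_forall fun x => ?_)
    dsimp only
    rw [mul_left_comm, ← Real.exp_add, neg_add_cancel, Real.exp_zero, mul_one]
  refine integrable_entIntegrand_and_ent_le_of_tendsto (hexp g hgm hK) (fun x => Real.exp_pos _)
    (fk := fun k x => Real.exp (G k x))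
    (fun k => hexp _ (hGC k).continuous.measurable (hGK k)) (fun k x => Real.exp_pos _)
    (fun x => ?_) ?_ (fun k => (hcs _ (hGC k) (hGs k)).1) (fun k => (hcs _ (hGC k) (hGs k)).2)
    (Filter.Tendsto.const_mul _ ?_)
  · refine tendsto_const_nhds.congr' ?_
    filter_upwards [hev x] with k hk
    rw [hk.eq_of_nhds]
  · refine tendsto_integral_of_dominated_convergence (fun _ => Real.exp K)
      (fun k => (hexp _ (hGC k).continuous.measurable (hGK k)).1) (integrable_const _)
      (fun k => .of_forall fun x => ?_) (.of_forall fun x => tendsto_const_nhds.congr' ?_)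
    · rw [Real.norm_of_nonneg (Real.exp_pos _).le]
      exact Real.exp_le_exp.2 ((le_abs_self _).trans (hGK k x))
    · filter_upwards [hev x] with k hk
      rw [hk.eq_of_nhds]
  · refine tendsto_integral_of_dominated_convergence
      (fun x => 2 ^ q * (‖fderiv ℝ g x‖ ^ q + (K * B) ^ q) * Real.exp K)
      (fun k => ?_) (((hdi.add (integrable_const _)).const_mul _).mul_const _)
      (fun k => .of_forall fun x => ?_) (.of_forall fun x => tendsto_const_nhds.congr' ?_)
    · have h1 := ((hGC k).continuous_fderiv one_ne_zero).norm.measurable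
      have h2 := (hGC k).continuous.measurable
      exact Measurable.aestronglyMeasurable (by fun_prop)
    · rw [Real.norm_of_nonneg (by positivity)]
      have h1 : ‖fderiv ℝ (G k) x‖ ^ q ≤ 2 ^ q * (‖fderiv ℝ g x‖ ^ q + (K * B) ^ q) := by
        have h2 : ‖fderiv ℝ (G k) x‖ ≤ 2 * max ‖fderiv ℝ g x‖ (K * B) := by
          linarith [hGd k x, le_max_left ‖fderiv ℝ g x‖ (K * B),
            le_max_right ‖fderiv ℝ g x‖ (K * B)]
        refine (Real.rpow_le_rpow (norm_nonneg _) h2 hq).trans ?_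
        rw [Real.mul_rpow (by norm_num) (by positivity)]
        gcongr
        rcases max_choice ‖fderiv ℝ g x‖ (K * B) with h | h <;> rw [h]
        · exact le_add_of_nonneg_right (by positivity)
        · exact le_add_of_nonneg_left (by positivity)
      have h3 := (le_abs_self _).trans (hGK k x)
      gcongr
    · filter_upwards [hev x] with k hk
      rw [hk.eq_of_nhds, hk.fderiv_eq]

/-- The function e^g is replaced by e^g/(1 + d e^g) + d, which lies between d and 1/d + d and so has
a bounded logarithm. The energy density never increases under this change, so the right side needs
no limit. -/
theorem EntropyBound.of_integrable (hq : 1 ≤ q) (hc : 0 ≤ c)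
    (hcs : ∀ g : E → ℝ, ContDiff ℝ 1 g → HasCompactSupport g → EntropyBound μ q c g)
    {g : E → ℝ} (hg : ContDiff ℝ 1 g) (hge : Integrable (fun x => Real.exp (g x)) μ)
    (hgi : Integrable (fun x => ‖fderiv ℝ g x‖ ^ q * Real.exp (g x)) μ) :
    EntropyBound μ q c g := by
  let d : ℕ → ℝ := fun k => ((k : ℝ) + 1)⁻¹
  have hd0 : ∀ k, 0 < d k := fun k => by positivity
  have hd1 : ∀ k, d k ≤ 1 := fun k => inv_le_one_of_one_le₀ (by linarith [k.cast_nonneg (α := ℝ)])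
  have hdlim : Filter.Tendsto d Filter.atTop (nhds 0) := by
    simpa [d, one_div] using tendsto_one_div_add_atTop_nhds_zero_nat (𝕜 := ℝ)
  let f : ℕ → E → ℝ := fun k x => Real.exp (g x) / (1 + d k * Real.exp (g x)) + d k
  have hden : ∀ k x, 0 < 1 + d k * Real.exp (g x) := fun k x => by have := hd0 k; positivity
  have hfd : ∀ k x, d k ≤ f k x := fun k x =>
    le_add_of_nonneg_left (div_nonneg (Real.exp_pos _).le (hden k x).le)
  have hf0 : ∀ k x, 0 < f k x := fun k x => (hd0 k).trans_le (hfd k x)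
  have hfu : ∀ k x, f k x ≤ (d k)⁻¹ + d k := fun k x => by
    refine add_le_add_left ?_ _
    rw [div_le_iff₀ (hden k x), mul_add, mul_one, inv_mul_cancel_left₀ (hd0 k).ne']
    exact le_add_of_nonneg_left (inv_nonneg.2 (hd0 k).le)
  have hfe : ∀ k x, f k x ≤ Real.exp (g x) + 1 := fun k x => by
    refine add_le_add (div_le_self (Real.exp_pos _).le ?_) (hd1 k)
    exact le_add_of_nonneg_right (mul_pos (hd0 k) (Real.exp_pos _)).le
  have hfC : ∀ k, ContDiff ℝ 1 (f k) := fun k =>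
    (hg.exp.div (contDiff_const.add (contDiff_const.mul hg.exp)) fun x => (hden k x).ne').add
      contDiff_const
  let G : ℕ → E → ℝ := fun k x => Real.log (f k x)
  have hGC : ∀ k, ContDiff ℝ 1 (G k) := fun k => (hfC k).log fun x => (hf0 k x).ne'
  have hGe : ∀ k x, Real.exp (G k x) = f k x := fun k x => Real.exp_log (hf0 k x)
  have hGb : ∀ k, ∃ K, ∀ x, |G k x| ≤ K := fun k => by
    refine ⟨max (Real.log ((d k)⁻¹ + d k)) (-Real.log (d k)), fun x => abs_le'.2 ⟨?_, ?_⟩⟩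
    · exact le_max_of_le_left (Real.log_le_log (hf0 k x) (hfu k x))
    · exact le_max_of_le_right (neg_le_neg (Real.log_le_log (hd0 k) (hfd k x)))
  have hGd : ∀ k x, ‖fderiv ℝ (G k) x‖ ^ q * Real.exp (G k x) ≤
      ‖fderiv ℝ g x‖ ^ q * Real.exp (g x) := by
    intro k x
    set F := Real.exp (g x) with hF
    have hF0 : 0 < F := Real.exp_pos _
    have hD := hden k x
    rw [← hF] at hD
    have hD1 : 1 ≤ 1 + d k * F := le_add_of_nonneg_right (mul_pos (hd0 k) hF0).le
    have h1 : HasFDerivAt (fun y => Real.exp (g y)) (F • fderiv ℝ g x) x :=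
      (hg.differentiable one_ne_zero x).hasFDerivAt.exp
    have h2 : HasDerivAt (fun u : ℝ => u / (1 + d k * u) + d k) (((1 + d k * F) ^ 2)⁻¹) F := by
      have := ((hasDerivAt_id F).div (((hasDerivAt_id F).const_mul (d k)).const_add 1)
        hD.ne').add_const (d k)
      refine this.congr_deriv ?_
      simp only [id]
      field_simp
      ring
    have h4 : HasFDerivAt (f k) (((1 + d k * F) ^ 2)⁻¹ • F • fderiv ℝ g x) x := by
      have := h2.comp_hasFDerivAt x h1
      exact this
    have h3 : HasFDerivAt (G k) ((f k x)⁻¹ • ((1 + d k * F) ^ 2)⁻¹ • F • fderiv ℝ g x) x :=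
      h4.log (hf0 k x).ne'
    -- The chain-rule factor, ∇G = ρ∇g. Since ρ ≤ 1 ≤ q, ρ^q f ≤ ρf = F/(1 + dF)² ≤ F.
    set ρ := F / (1 + d k * F) ^ 2 / f k x with hρ
    have hρ0 : 0 ≤ ρ := div_nonneg (by positivity) (hf0 k x).le
    have hn : ‖fderiv ℝ (G k) x‖ = ρ * ‖fderiv ℝ g x‖ := by
      rw [h3.fderiv, smul_smul, smul_smul, norm_smul, Real.norm_of_nonneg]
      · rw [hρ]
        ring
      · have := hf0 k x
        positivity
    have hρf : ρ * f k x = F / (1 + d k * F) ^ 2 := div_mul_cancel₀ _ (hf0 k x).ne'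
    have hρ1 : ρ ≤ 1 := by
      rw [hρ, div_le_one (hf0 k x)]
      calc F / (1 + d k * F) ^ 2 ≤ F / (1 + d k * F) := by
            gcongr
            nlinarith
        _ ≤ f k x := le_add_of_nonneg_right (hd0 k).le
    have hρq : ρ ^ q ≤ ρ := by
      simpa using Real.rpow_le_rpow_of_exponent_ge' hρ0 hρ1 zero_le_one hq
    rw [hn, hGe, Real.mul_rpow hρ0 (norm_nonneg _)]
    calc ρ ^ q * ‖fderiv ℝ g x‖ ^ q * f k x = (ρ ^ q * f k x) * ‖fderiv ℝ g x‖ ^ q := by ring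
      _ ≤ F * ‖fderiv ℝ g x‖ ^ q := by
          gcongr
          calc ρ ^ q * f k x ≤ ρ * f k x := mul_le_mul_of_nonneg_right hρq (hf0 k x).le
            _ = F / (1 + d k * F) ^ 2 := hρf
            _ ≤ F := div_le_self hF0.le (one_le_pow₀ hD1)
      _ = _ := mul_comm _ _
  have hGi : ∀ k, Integrable (fun x => ‖fderiv ℝ (G k) x‖ ^ q * Real.exp (G k x)) μ := fun k => by
    refine hgi.mono' ?_ (.of_forall fun x => ?_)
    · have h1 := ((hGC k).continuous_fderiv one_ne_zero).norm.measurable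
      have h2 := (hGC k).continuous.measurable
      exact Measurable.aestronglyMeasurable (by fun_prop)
    · rw [Real.norm_of_nonneg (by positivity)]
      exact hGd k x
  have hB : ∀ k, EntropyBound μ q c (G k) := fun k => by
    obtain ⟨K, hK⟩ := hGb k
    exact EntropyBound.of_bounded (by linarith) hcs (hGC k) hK (hGi k)
  have hfi : ∀ k, Integrable (f k) μ := fun k => by
    refine (hge.add (integrable_const 1)).mono' (hfC k).continuous.aestronglyMeasurable
      (.of_forall fun x => ?_)
    rw [Real.norm_of_nonneg (hf0 k x).le]
    exact hfe k x
  have hflim : ∀ x, Filter.Tendsto (fun k => f k x) Filter.atTop (nhds (Real.exp (g x))) := by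
    intro x
    have h1 : ContinuousAt (fun u : ℝ => Real.exp (g x) / (1 + u * Real.exp (g x)) + u) 0 := by
      refine ContinuousAt.add (ContinuousAt.div (by fun_prop) (by fun_prop) (by simp)) (by fun_prop)
    have h2 := h1.tendsto.comp hdlim
    simp only [zero_mul, add_zero, div_one] at h2
    exact h2
  have hEk : ∀ k, (fun x => Real.exp (G k x)) = f k := fun k => funext (hGe k)
  refine integrable_entIntegrand_and_ent_le_of_tendsto hge (fun x => Real.exp_pos _)
    hfi hf0 hflim ?_ (fun k => hEk k ▸ (hB k).1) (fun k => ?_) tendsto_const_nhds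
  · exact tendsto_integral_of_dominated_convergence (fun x => Real.exp (g x) + 1)
      (fun k => (hfi k).1) (hge.add (integrable_const 1))
      (fun k => .of_forall fun x => by rw [Real.norm_of_nonneg (hf0 k x).le]; exact hfe k x)
      (.of_forall hflim)
  · rw [← hEk k]
    exact (hB k).2.trans
      (mul_le_mul_of_nonneg_left (integral_mono (hGi k) hgi (hGd k)) hc)

end Approximation

/-! ### The power potential and the main theorem. -/

/-- Comparison with a Gaussian, through |x|² ≤ |x|^p + 1. -/
theorem integrable_exp_neg_powerPotential (n : ℕ) {p : ℝ} (hp : 2 ≤ p) :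
    Integrable fun x => Real.exp (-powerPotential n p x) := by
  have hp0 : 0 < p := by linarith
  have hG : Integrable fun x : EuclideanSpace ℝ (Fin n) => Real.exp (-p⁻¹ * ‖x‖ ^ 2) := by
    have := GaussianFourier.integrable_cexp_neg_mul_sq_norm_add_of_euclideanSpace
      (ι := Fin n) (b := (p⁻¹ : ℂ)) (by simpa using hp0) 0 0
    refine this.norm.congr (.of_forall fun x => ?_)
    simp only [Complex.norm_exp]
    congr 1
    norm_cast
    simp
  refine (hG.const_mul (Real.exp p⁻¹)).mono' ?_ (.of_forall fun x => ?_)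
  · unfold powerPotential
    exact Measurable.aestronglyMeasurable (by fun_prop)
  · rw [Real.norm_of_nonneg (Real.exp_pos _).le, ← Real.exp_add, powerPotential]
    refine Real.exp_le_exp.2 ?_
    have h1 : ‖x‖ ^ 2 ≤ ‖x‖ ^ p + 1 := by
      rcases le_total ‖x‖ 1 with h | h
      · have : ‖x‖ ^ 2 ≤ 1 := pow_le_one₀ (norm_nonneg _) h
        have : 0 ≤ ‖x‖ ^ p := by positivity
        linarith
      · have := Real.rpow_le_rpow_of_exponent_le h hp
        rw [Real.rpow_two] at this
        linarith
    have h2 := mul_le_mul_of_nonneg_left h1 (inv_pos.2 hp0).le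
    rw [div_eq_inv_mul]
    linarith

theorem powerPotential_uniformly_convex (n : ℕ) {p : ℝ} (hp : 2 ≤ p) {s : ℝ} (hs : 0 ≤ s)
    (hs2 : s ≤ 1 / 2) (x y : EuclideanSpace ℝ (Fin n)) :
    powerPotential n p ((1 - s) • x + s • y) ≤
      (1 - s) * powerPotential n p x + s * powerPotential n p y -
        2 * (1 / 2) ^ p / p * s * ‖x - y‖ ^ p := by
  have hp0 : 0 < p := by linarith
  have := div_le_div_of_nonneg_right (norm_rpow_uniformly_convex hp hs hs2 x y) hp0.le
  unfold powerPotential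
  refine this.trans (le_of_eq ?_)
  ring

end ModifiedLogSobolev

theorem mainTheorem3 (n : ℕ) (p q : ℝ) (hp : 2 ≤ p) (hpq : 1 / p + 1 / q = 1) :
    IsProbabilityMeasure
        (ModifiedLogSobolev.gibbs (ModifiedLogSobolev.powerPotential n p)) ∧
      ∃ c : ℝ, 0 < c ∧
        ∀ g : EuclideanSpace ℝ (Fin n) → ℝ, ContDiff ℝ 1 g →
          Integrable (fun x => Real.exp (g x))
            (ModifiedLogSobolev.gibbs (ModifiedLogSobolev.powerPotential n p)) →
          Integrable (fun x => ‖gradient g x‖ ^ q * Real.exp (g x))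
            (ModifiedLogSobolev.gibbs (ModifiedLogSobolev.powerPotential n p)) →
          Integrable
            (ModifiedLogSobolev.entIntegrand
              (ModifiedLogSobolev.gibbs (ModifiedLogSobolev.powerPotential n p))
              (fun x => Real.exp (g x)))
            (ModifiedLogSobolev.gibbs (ModifiedLogSobolev.powerPotential n p)) ∧
          ModifiedLogSobolev.ent
              (ModifiedLogSobolev.gibbs (ModifiedLogSobolev.powerPotential n p))
              (fun x => Real.exp (g x)) ≤
            c * ∫ x, ‖gradient g x‖ ^ q * Real.exp (g x)
              ∂(ModifiedLogSobolev.gibbs (ModifiedLogSobolev.powerPotential n p)) := by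
  have hconj : p.HolderConjugate q :=
    Real.holderConjugate_iff.2 ⟨by linarith, by simpa only [one_div] using hpq⟩
  have hΦi := ModifiedLogSobolev.integrable_exp_neg_powerPotential n hp
  have hprob := ModifiedLogSobolev.isProbabilityMeasure_gibbs hΦi
  refine ⟨hprob, ?_⟩
  have hΦ : Measurable (ModifiedLogSobolev.powerPotential n p) := by
    unfold ModifiedLogSobolev.powerPotential
    fun_prop
  have hκ : 0 < 2 * (1 / 2 : ℝ) ^ p / p := by
    have := hconj.pos
    positivity
  -- Young's constant at the convexity modulus of Φ; it involves only p and its conjugate q, not n.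
  obtain ⟨c, hc, hY⟩ := Real.exists_young_const hconj hκ
  refine ⟨c, hc, fun g hg hge hgi => ?_⟩
  have hnorm : ∀ x, ‖gradient g x‖ = ‖fderiv ℝ g x‖ := fun x =>
    (InnerProductSpace.toDual ℝ (EuclideanSpace ℝ (Fin n))).symm.norm_map _
  simp only [hnorm] at hgi ⊢
  refine ModifiedLogSobolev.EntropyBound.of_integrable hconj.symm.lt.le hc.le (fun g hg hgc => ?_)
    hg hge hgi
  obtain ⟨K, hK⟩ := hgc.exists_bound_of_continuous hg.continuous
  have hgm : Measurable g := hg.continuous.measurable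
  have hexp : Integrable (fun x => Real.exp (g x))
      (ModifiedLogSobolev.gibbs (ModifiedLogSobolev.powerPotential n p)) :=
    Integrable.of_bound (by fun_prop) (Real.exp K) (.of_forall fun x => by
      rw [Real.norm_of_nonneg (Real.exp_pos _).le]
      exact Real.exp_le_exp.2 ((le_abs_self _).trans (hK x)))
  have hent := ModifiedLogSobolev.entIntegrand_exp (integral_exp_pos hexp)
  refine ⟨?_, ?_⟩
  · simp only [funext hent, mul_sub]
    exact (hexp.mul_bdd (c := K) (by fun_prop) (.of_forall hK)).sub (hexp.mul_const _)
  · simp only [ModifiedLogSobolev.ent, hent]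
    exact ModifiedLogSobolev.entropy_le_of_hasCompactSupport hΦ hΦi hp hconj.symm.nonneg hκ hc.le
      hY (fun s hs hs2 x y => ModifiedLogSobolev.powerPotential_uniformly_convex n hp hs hs2 x y)
      hg hgc
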